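/- For integers $m\ge 2$ and $h\ge 0$, let $T_{m,h}$ be the complete $m$-ary tree of height $h$: the rooted tree in which every vertex at depth less than $h$ has exactly $m$ children and the vertices at depth $h$ are the leaves. The thinness $\mathrm{thin}(G)$ of a finite graph $G=(V,E)$ is the minimum $k$ for which there are a linear ordering $<$ of $V$ and a partition of $V$ into $k$ classes such that, for all vertices $r<s<t$, if $r$ and $s$ belong to the same class and $tr\in E$, then $ts\in E$. For every fixed integer $m\ge 2$, the thinness of the complete $m$-ary tree on $n$ vertices is $\Theta(\log n)$. That is, with $n_{m,h}=|V(T_{m,h})|$ the number of vertices of $T_{m,h}$, $$\mathrm{thin}(T_{m,h})=\Theta(\log n_{m,h})\qquad\text{as } h\to\infty,$$ where the implied constants may depend on $m$. -/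

import Mathlib

/-- A linear ordering of the vertices and a partition of the vertices (given as the map `c` that
sends a vertex to the index of its class) are consistent if, for all `r < s < t` such that
`r`, `s` are in the same class and `t` is adjacent to `r`, also `t` is adjacent to `s`. -/
def SimpleGraph.IsConsistent {V : Type*} (G : SimpleGraph V) (ord : LinearOrder V)
    {k : ℕ} (c : V → Fin k) : Prop :=
  ∀ r s t : V, ord.lt r s → ord.lt s t → c r = c s → G.Adj t r → G.Adj t s

/-- A graph is `k`-thin if it has an ordering and a partition into `k` (possibly empty) classes
that are consistent. -/
def SimpleGraph.IsThin {V : Type*} (G : SimpleGraph V) (k : ℕ) : Prop :=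
  ∃ (ord : LinearOrder V) (c : V → Fin k), G.IsConsistent ord c

/-- Every finite graph is `k`-thin for some `k` (take all classes to be singletons). -/
theorem SimpleGraph.exists_isThin {V : Type*} [Finite V] (G : SimpleGraph V) :
    ∃ k, G.IsThin k := by
  let e := Finite.equivFin V
  refine ⟨Nat.card V, LinearOrder.lift' e e.injective, e, ?_⟩
  intro r s t _ _ hc hadj
  rw [← e.injective hc]
  exact hadj

/-- The thinness of a finite graph: the least `k` such that it is `k`-thin. -/
noncomputable def SimpleGraph.thinness {V : Type*} [Finite V] (G : SimpleGraph V) : ℕ :=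
  sInf {k : ℕ | G.IsThin k}

/-- The vertices of the complete `m`-ary tree of height `h`: the words of length at most `h` over
an alphabet with `m` letters. The empty word is the root and the length of a word is its depth. -/
abbrev CompleteTreeVertex (m h : ℕ) : Type := {w : List (Fin m) // w.length ≤ h}

instance CompleteTreeVertex.instFinite (m h : ℕ) : Finite (CompleteTreeVertex m h) :=
  (List.finite_length_le (Fin m) h).to_subtype

/-- The complete `m`-ary tree of height `h`: the children of the vertex `w`, if its depth is less
than `h`, are the `m` words `a :: w`, and the edges join each vertex to its children. -/
def completeTree (m h : ℕ) : SimpleGraph (CompleteTreeVertex m h) where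
  Adj u v := (∃ a : Fin m, v.1 = a :: u.1) ∨ (∃ a : Fin m, u.1 = a :: v.1)
  symm := ⟨fun _ _ huv => huv.symm⟩
  loopless := ⟨fun u hu => by
    rcases hu with ⟨a, ha⟩ | ⟨a, ha⟩ <;> simpa using congrArg List.length ha⟩

/-!
The thinness of the complete `m`-ary tree of height `h` lies between `h / 3` and `h + 1`, and the
number of its vertices lies between `m ^ h` and `(m + 1) ^ h`.

*Upper bound.* Order the vertices by reverse preorder, so that every vertex comes after its
descendants, and let the classes be the levels of the tree. If `r < s < t`, the vertices `r` and `s`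
have the same depth and `t` is adjacent to `r`, then `t` is the parent of `r`. The vertices between
`r` and `t` are descendants of `t`, so `s` is a child of `t`, too. See `completeTree_isThin`.

*Lower bound.* An induced matching across a cut of the ordering, with all left ends before all right
ends, has its left ends in distinct classes. So it suffices to find, for every ordering, a cut that
is crossed by a large induced matching (`exists_isCutMatching`). This goes by induction: three
levels below any vertex `q` there are three subtrees whose roots have distinct parents, and each has a
cut with an induced matching of size `k`. Take the middle one of the three
cuts, belonging to the subtree with root `c :: p`. One of the other subtrees has a vertex on
the left of this cut, the other one has a vertex on its right, and the part of the tree outside the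
subtree at `p` is connected. So this part contains an edge across the cut, and as it has no edge to
the subtree at `c :: p`, the matching extends to size `k + 1`.
-/

/-! ### Upper bound -/

theorem List.exists_eq_append_singleton_of_lt_of_lt {α : Type*} [LinearOrder α] {a : α} :
    ∀ {t s : List α}, t < s → s < t ++ [a] → s.length = t.length + 1 → ∃ b, s = t ++ [b]
  | [], s, _, _, hl => List.length_eq_one_iff.1 (by simpa using hl)
  | x :: t, [], _, _, hl => by simp at hl
  | x :: t, y :: s, h₁, h₂, hl => by
    rw [List.cons_append, List.cons_lt_cons_iff] at h₂
    rw [List.cons_lt_cons_iff] at h₁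
    rcases h₁ with h₁ | ⟨rfl, h₁⟩
    · rcases h₂ with h₂ | ⟨rfl, -⟩
      · exact absurd h₁ h₂.asymm
      · exact absurd h₁ (lt_irrefl _)
    · rcases h₂ with h₂ | ⟨-, h₂⟩
      · exact absurd h₂ (lt_irrefl _)
      · obtain ⟨b, rfl⟩ :=
          List.exists_eq_append_singleton_of_lt_of_lt h₁ h₂ (by simpa using hl)
        exact ⟨b, rfl⟩

theorem completeTree_isThin (m h : ℕ) : (completeTree m h).IsThin (h + 1) := by
  -- A word lists the steps from the root backwards, so the lexicographic order of the reversed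
  -- words is the preorder of the tree.
  let f : CompleteTreeVertex m h → (List (Fin m))ᵒᵈ := fun w => OrderDual.toDual w.1.reverse
  have hf : Function.Injective f := fun u v huv =>
    Subtype.ext (List.reverse_injective (OrderDual.toDual.injective huv))
  refine ⟨LinearOrder.lift' f hf, fun w => ⟨w.1.length, Nat.lt_succ_of_le w.2⟩, ?_⟩
  intro r s t hrs hst hc hadj
  have hrs : s.1.reverse < r.1.reverse := hrs
  have hst : t.1.reverse < s.1.reverse := hst
  have hc : r.1.length = s.1.length := by simpa using hc
  rcases hadj with ⟨a, ha⟩ | ⟨a, ha⟩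
  · rw [ha, List.reverse_cons] at hrs
    obtain ⟨b, hb⟩ := List.exists_eq_append_singleton_of_lt_of_lt hst hrs (by simp [← hc, ha])
    exact Or.inl ⟨b, by simpa using congrArg List.reverse hb⟩
  · rw [ha, List.reverse_cons] at hst
    have h₁ : r.1.reverse < r.1.reverse ++ [a] := by
      simpa using List.append_left_lt (l₁ := r.1.reverse) (List.nil_lt_cons a [])
    exact absurd (hst.trans hrs) h₁.asymm

/-! ### Lower bound -/

/-- The adjacency relation of the infinite tree of all words: a word `u` is adjacent to the words
`a :: u`. The subtree of the descendants of `q` consists of the words with suffix `q`. -/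
def WordAdj {α : Type*} (u v : List α) : Prop :=
  (∃ a : α, v = a :: u) ∨ (∃ a : α, u = a :: v)

theorem WordAdj.symm {α : Type*} {u v : List α} (h : WordAdj u v) : WordAdj v u := Or.symm h

theorem not_wordAdj_of_suffix {α : Type*} {c : α} {p u v : List α}
    (hu : ¬ p <:+ u) (hv : c :: p <:+ v) : ¬ WordAdj u v := by
  rintro (⟨a, rfl⟩ | ⟨a, rfl⟩)
  · rcases List.suffix_cons_iff.1 hv with h | h
    · exact hu (by simp_all)
    · exact hu ((List.suffix_cons c p).trans h)
  · exact hu (((List.suffix_cons c p).trans hv).trans (List.suffix_cons a v))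

/-- On the way from a vertex `u` up to its ancestor `q`, a property that holds at `u` and fails at
`q` gets lost along some edge. -/
theorem exists_cons_suffix_of_not {α : Type*} {P : List α → Prop} {q : List α} (hq : ¬ P q) :
    ∀ {u : List α}, q <:+ u → P u → ∃ a y, q <:+ y ∧ a :: y <:+ u ∧ P (a :: y) ∧ ¬ P y
  | [], hu, h => absurd (List.suffix_nil.1 hu ▸ h) hq
  | a :: y, hu, h => by
    rcases List.suffix_cons_iff.1 hu with rfl | hy
    · exact absurd h hq
    · by_cases hP : P y
      · obtain ⟨b, z, hz, hzy, h'⟩ := exists_cons_suffix_of_not hq hy hP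
        exact ⟨b, z, hz, hzy.trans (List.suffix_cons a y), h'⟩
      · exact ⟨a, y, hy, List.suffix_rfl, h, hP⟩

/-- If the vertices `u` and `v` below `q` lie on different sides of a cut, then the cut is crossed by
an edge of the path from `u` to `q` or of the path from `v` to `q`. -/
theorem exists_wordAdj_of_suffix {α : Type*} {P : List α → Prop} {q u v : List α}
    (hqu : q <:+ u) (hqv : q <:+ v) (hu : P u) (hv : ¬ P v) :
    ∃ x y, WordAdj x y ∧ P x ∧ ¬ P y ∧ q <:+ x ∧ q <:+ y ∧
      (x <:+ u ∧ y <:+ u ∨ x <:+ v ∧ y <:+ v) := by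
  by_cases hq : P q
  · obtain ⟨a, y, hy, hyv, h₁, h₂⟩ :=
      exists_cons_suffix_of_not (P := fun w => ¬ P w) (not_not.2 hq) hqv hv
    exact ⟨y, a :: y, Or.inl ⟨a, rfl⟩, not_not.1 h₂, h₁, hy, hy.trans (List.suffix_cons a y),
      Or.inr ⟨(List.suffix_cons a y).trans hyv, hyv⟩⟩
  · obtain ⟨a, y, hy, hyu, h₁, h₂⟩ := exists_cons_suffix_of_not hq hqu hu
    exact ⟨a :: y, y, Or.inr ⟨a, rfl⟩, h₁, h₂, hy.trans (List.suffix_cons a y), hy,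
      Or.inl ⟨hyu, (List.suffix_cons a y).trans hyu⟩⟩

/-- The edges from `x i` to `y i`, where `i : Fin k`, form an induced matching across the cut of the
vertices into those with `ρ w ≤ t` and those with `t < ρ w`, among the descendants of `q` of depth
at most `h`. Edges between two vertices on the same side of the cut are disregarded. -/
structure IsCutMatching {α β : Type*} [LinearOrder β] (h : ℕ) (ρ : List α → β) (t : β)
    (q : List α) {k : ℕ} (x y : Fin k → List α) : Prop where
  suffix_left (i : Fin k) : q <:+ x i
  suffix_right (i : Fin k) : q <:+ y i
  length_left (i : Fin k) : (x i).length ≤ h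
  length_right (i : Fin k) : (y i).length ≤ h
  left_le (i : Fin k) : ρ (x i) ≤ t
  lt_right (i : Fin k) : t < ρ (y i)
  adj (i : Fin k) : WordAdj (x i) (y i)
  not_adj (i j : Fin k) : i ≠ j → ¬ WordAdj (x i) (y j)

/-- Three vertices two levels below `q`, distinct if `a ≠ b`. They are the parents of the roots of the
three subtrees in the induction step. -/
def threeGrandchildren {α : Type*} (a b : α) (q : List α) : Fin 3 → List α :=
  ![a :: a :: q, b :: a :: q, a :: b :: q]

theorem length_threeGrandchildren {α : Type*} (a b : α) (q : List α) (i : Fin 3) :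
    (threeGrandchildren a b q i).length = q.length + 2 := by
  fin_cases i <;> rfl

theorem suffix_threeGrandchildren {α : Type*} (a b : α) (q : List α) (i : Fin 3) :
    q <:+ threeGrandchildren a b q i := by
  fin_cases i <;> exact (List.suffix_cons _ _).trans (List.suffix_cons _ _)

theorem threeGrandchildren_injective {α : Type*} {a b : α} (hab : a ≠ b) (q : List α) :
    Function.Injective (threeGrandchildren a b q) := by
  intro i j hij
  fin_cases i <;> fin_cases j <;> simp_all [threeGrandchildren, eq_comm]

theorem not_suffix_of_threeGrandchildren {α : Type*} {a b : α} (hab : a ≠ b) {q w : List α}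
    {i j : Fin 3} (hij : i ≠ j) (hw : threeGrandchildren a b q i <:+ w) :
    ¬ threeGrandchildren a b q j <:+ w := by
  intro hw'
  have hl : (threeGrandchildren a b q i).length = (threeGrandchildren a b q j).length := by
    simp only [length_threeGrandchildren]
  exact hij (threeGrandchildren_injective hab q
    ((List.suffix_of_suffix_length_le hw hw' hl.le).eq_of_length hl))

/-- For every ordering, given by `ρ`, some cut is crossed by a large induced matching.
Injectivity of `ρ` is only needed for a vertex and its first child, at the start of the induction. -/
theorem exists_isCutMatching {α β : Type*} [LinearOrder β] {a b : α} (hab : a ≠ b) {h : ℕ}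
    {ρ : List α → β} (hρ : ∀ w : List α, w.length + 1 ≤ h → ρ w ≠ ρ (a :: w)) (k : ℕ) :
    ∀ q : List α, q.length + (3 * k + 1) ≤ h →
      ∃ (t : β) (x y : Fin (k + 1) → List α), IsCutMatching h ρ t q x y := by
  induction k with
  | zero =>
    intro q hq
    have hsub : ∀ i j : Fin (0 + 1), i = j := by decide
    have hq₁ : (a :: q).length ≤ h := by simpa using hq
    have hq₀ : q.length ≤ h := by omega
    rcases lt_or_gt_of_ne (hρ q (by omega)) with hlt | hlt
    · exact ⟨ρ q, fun _ => q, fun _ => a :: q, fun _ => List.suffix_rfl,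
        fun _ => List.suffix_cons a q, fun _ => hq₀, fun _ => hq₁, fun _ => le_rfl, fun _ => hlt,
        fun _ => Or.inl ⟨a, rfl⟩, fun i j hij => absurd (hsub i j) hij⟩
    · exact ⟨ρ (a :: q), fun _ => a :: q, fun _ => q, fun _ => List.suffix_cons a q,
        fun _ => List.suffix_rfl, fun _ => hq₁, fun _ => hq₀, fun _ => le_rfl, fun _ => hlt,
        fun _ => Or.inr ⟨a, rfl⟩, fun i j hij => absurd (hsub i j) hij⟩
  | succ k ih =>
    intro q hq
    let p := threeGrandchildren a b q
    have hqp : ∀ i, q <:+ p i := suffix_threeGrandchildren a b q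
    have hpc : ∀ i, p i <:+ a :: p i := fun i => List.suffix_cons a (p i)
    choose t x y hM using fun i : Fin 3 => ih (a :: p i) (by
      have : (p i).length = q.length + 2 := length_threeGrandchildren a b q i
      rw [List.length_cons]
      omega)
    -- The three cuts in increasing order have the indices `l`, `i`, `r`.
    let σ := Tuple.sort t
    have hσ : Monotone (t ∘ σ) := Tuple.monotone_sort t
    obtain ⟨l, i, r, hli, hri, htl, htr⟩ :
        ∃ l i r : Fin 3, l ≠ i ∧ r ≠ i ∧ t l ≤ t i ∧ t i ≤ t r :=
      ⟨σ 0, σ 1, σ 2, σ.injective.ne (by decide), σ.injective.ne (by decide),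
        hσ (by decide : (0 : Fin 3) ≤ 1), hσ (by decide : (1 : Fin 3) ≤ 2)⟩
    have hl := (hpc l).trans ((hM l).suffix_left 0)
    have hr := (hpc r).trans ((hM r).suffix_right 0)
    have hl' : ¬ p i <:+ x l 0 := not_suffix_of_threeGrandchildren hab hli hl
    have hr' : ¬ p i <:+ y r 0 := not_suffix_of_threeGrandchildren hab hri hr
    obtain ⟨u, v, huv, hu, hv, hqu, hqv, hside⟩ :=
      exists_wordAdj_of_suffix (P := fun w => ρ w ≤ t i) ((hqp l).trans hl) ((hqp r).trans hr)
        (((hM l).left_le 0).trans htl) (not_le.2 (htr.trans_lt ((hM r).lt_right 0)))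
    obtain ⟨hpu, hpv, hhu, hhv⟩ :
        ¬ p i <:+ u ∧ ¬ p i <:+ v ∧ u.length ≤ h ∧ v.length ≤ h := by
      rcases hside with ⟨h₁, h₂⟩ | ⟨h₁, h₂⟩
      · exact ⟨fun hp => hl' (hp.trans h₁), fun hp => hl' (hp.trans h₂),
          h₁.length_le.trans ((hM l).length_left 0), h₂.length_le.trans ((hM l).length_left 0)⟩
      · exact ⟨fun hp => hr' (hp.trans h₁), fun hp => hr' (hp.trans h₂),
          h₁.length_le.trans ((hM r).length_right 0), h₂.length_le.trans ((hM r).length_right 0)⟩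
    have hqi : q <:+ a :: p i := (hqp i).trans (hpc i)
    refine ⟨t i, Fin.cons u (x i), Fin.cons v (y i), ?_, ?_, ?_, ?_, ?_, ?_, ?_, ?_⟩
    · exact Fin.cases hqu fun n => hqi.trans ((hM i).suffix_left n)
    · exact Fin.cases hqv fun n => hqi.trans ((hM i).suffix_right n)
    · exact Fin.cases hhu (hM i).length_left
    · exact Fin.cases hhv (hM i).length_right
    · exact Fin.cases hu (hM i).left_le
    · exact Fin.cases (not_le.1 hv) (hM i).lt_right
    · exact Fin.cases huv (hM i).adj
    · refine Fin.cases (Fin.cases (fun hne => absurd rfl hne) fun n _ => ?_) fun n =>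
        Fin.cases (fun _ => ?_) fun n' hne => ?_
      · exact not_wordAdj_of_suffix hpu ((hM i).suffix_right n)
      · exact fun hadj => not_wordAdj_of_suffix hpv ((hM i).suffix_left n) hadj.symm
      · exact (hM i).not_adj n n' fun hnn => hne (congrArg Fin.succ hnn)

/-- The left ends of an induced matching across a cut of the ordering are in distinct classes. -/
theorem lt_of_isThin_completeTree {m h k j : ℕ} (hm : 2 ≤ m) (hj : 3 * j + 1 ≤ h)
    (hk : (completeTree m h).IsThin k) : j < k := by
  obtain ⟨ord, c, hc⟩ := hk
  -- The type of the vertices carries the lexicographic order as well; `β` keeps `ord` apart from it.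
  obtain ⟨β, _, e, he⟩ : ∃ (β : Type) (_ : LinearOrder β) (e : CompleteTreeVertex m h → β),
      (∀ u v, e u < e v ↔ ord.lt u v) ∧ Function.Injective e :=
    ⟨CompleteTreeVertex m h, ord, id, fun _ _ => Iff.rfl, Function.injective_id⟩
  let ρ : List (Fin m) → β := fun w =>
    if hw : w.length ≤ h then e ⟨w, hw⟩ else e ⟨[], Nat.zero_le h⟩
  have hρ : ∀ w (hw : w.length ≤ h), ρ w = e ⟨w, hw⟩ := fun w hw => dif_pos hw
  have hab : (⟨0, by omega⟩ : Fin m) ≠ ⟨1, by omega⟩ := by simp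
  obtain ⟨t, x, y, hM⟩ := exists_isCutMatching hab (h := h) (ρ := ρ) (fun w hw hww => by
    rw [hρ w (by omega), hρ _ (by simpa using hw)] at hww
    simpa using congrArg Subtype.val (he.2 hww)) j [] (by simpa using hj)
  let x' : Fin (j + 1) → CompleteTreeVertex m h := fun i => ⟨x i, hM.length_left i⟩
  let y' : Fin (j + 1) → CompleteTreeVertex m h := fun i => ⟨y i, hM.length_right i⟩
  have hxy : ∀ i n, ord.lt (x' i) (y' n) := fun i n => (he.1 _ _).1 (by
    have h₁ := (hM.left_le i).trans_lt (hM.lt_right n)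
    rwa [hρ _ (hM.length_left i), hρ _ (hM.length_right n)] at h₁)
  have hne : ∀ i n, ord.lt (x' i) (x' n) → c (x' i) = c (x' n) → i = n := by
    intro i n hlt hcc
    by_contra hin
    have h₁ : (completeTree m h).Adj (y' i) (x' n) :=
      hc _ _ _ hlt (hxy n i) hcc (WordAdj.symm (hM.adj i))
    exact hM.not_adj n i (Ne.symm hin) (WordAdj.symm h₁)
  have hinj : Function.Injective fun i => c (x' i) := by
    intro i n hcc
    rcases lt_trichotomy (e (x' i)) (e (x' n)) with hlt | heq | hlt
    · exact hne i n ((he.1 _ _).1 hlt) hcc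
    · by_contra hin
      have hx : x i = x n := congrArg Subtype.val (he.2 heq)
      exact hM.not_adj i n hin (hx ▸ hM.adj n)
    · exact (hne n i ((he.1 _ _).1 hlt) hcc.symm).symm
  simpa using Fintype.card_le_of_injective _ hinj

/-! ### The number of vertices -/

theorem pow_le_card_completeTreeVertex (m h : ℕ) :
    m ^ h ≤ Nat.card (CompleteTreeVertex m h) := by
  let f : (Fin h → Fin m) → CompleteTreeVertex m h := fun g => ⟨List.ofFn g, by simp⟩
  have hf : Function.Injective f := fun g g' hg =>
    List.ofFn_injective (congrArg Subtype.val hg)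
  simpa using Nat.card_le_card_of_injective f hf

/-- A word of length at most `h` is a sequence of `h` symbols from the alphabet enlarged by a blank,
with all blanks at the end. -/
theorem card_completeTreeVertex_le (m h : ℕ) :
    Nat.card (CompleteTreeVertex m h) ≤ (m + 1) ^ h := by
  let f : CompleteTreeVertex m h → (Fin h → Option (Fin m)) := fun w i => w.1[i.1]?
  have hf : Function.Injective f := by
    refine fun u v huv => Subtype.ext (List.ext_getElem? fun i => ?_)
    by_cases hi : i < h
    · exact congrFun huv ⟨i, hi⟩
    · rw [List.getElem?_eq_none (u.2.trans (not_lt.1 hi)),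
        List.getElem?_eq_none (v.2.trans (not_lt.1 hi))]
  simpa using Nat.card_le_card_of_injective f hf

/-! ### Logarithmic growth -/

theorem thinness_completeTree_le (m h : ℕ) : (completeTree m h).thinness ≤ h + 1 :=
  Nat.sInf_le (completeTree_isThin m h)

theorem le_three_mul_thinness_completeTree {m : ℕ} (hm : 2 ≤ m) {h : ℕ} (hh : 1 ≤ h) :
    h ≤ 3 * (completeTree m h).thinness := by
  have hthin : (completeTree m h).IsThin (completeTree m h).thinness :=
    Nat.sInf_mem (completeTree m h).exists_isThin
  have := lt_of_isThin_completeTree (j := (h - 1) / 3) hm (by omega) hthin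
  omega

theorem mainTheorem9 (m : ℕ) (hm : 2 ≤ m) :
    Asymptotics.IsTheta Filter.atTop
      (fun h : ℕ => ((completeTree m h).thinness : ℝ))
      (fun h : ℕ => Real.log (Nat.card (CompleteTreeVertex m h) : ℝ)) := by
  have hlog2 : 0 < Real.log 2 := Real.log_pos one_lt_two
  have hlower : ∀ h : ℕ, h * Real.log 2 ≤ Real.log (Nat.card (CompleteTreeVertex m h)) := by
    intro h
    rw [← Real.log_pow]
    refine Real.log_le_log (by positivity) ?_
    exact_mod_cast (Nat.pow_le_pow_left hm h).trans (pow_le_card_completeTreeVertex m h)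
  have hupper : ∀ h : ℕ,
      Real.log (Nat.card (CompleteTreeVertex m h)) ≤ h * Real.log (m + 1) := by
    intro h
    rw [← Real.log_pow]
    refine Real.log_le_log ?_ (by exact_mod_cast card_completeTreeVertex_le m h)
    exact_mod_cast (Nat.pow_pos (by omega)).trans_le (pow_le_card_completeTreeVertex m h)
  have hpos : ∀ h : ℕ, 0 ≤ Real.log (Nat.card (CompleteTreeVertex m h)) := fun h =>
    (by positivity : 0 ≤ h * Real.log 2).trans (hlower h)
  constructor
  · refine Asymptotics.IsBigO.of_bound (2 / Real.log 2) ?_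
    filter_upwards [Filter.eventually_ge_atTop 1] with h hh
    rw [Real.norm_of_nonneg (Nat.cast_nonneg _), Real.norm_of_nonneg (hpos h)]
    have h₁ : ((completeTree m h).thinness : ℝ) ≤ 2 * h := by
      exact_mod_cast (thinness_completeTree_le m h).trans (by omega)
    calc ((completeTree m h).thinness : ℝ) ≤ 2 * h := h₁
      _ = 2 / Real.log 2 * (h * Real.log 2) := by field_simp
      _ ≤ _ := by gcongr; exact hlower h
  · refine Asymptotics.IsBigO.of_bound (3 * Real.log (m + 1)) ?_
    filter_upwards [Filter.eventually_ge_atTop 1] with h hh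
    rw [Real.norm_of_nonneg (Nat.cast_nonneg _), Real.norm_of_nonneg (hpos h)]
    have h₁ : (h : ℝ) ≤ 3 * (completeTree m h).thinness := by
      exact_mod_cast le_three_mul_thinness_completeTree hm hh
    have h₂ : 0 ≤ Real.log ((m : ℝ) + 1) := Real.log_nonneg (by simp)
    calc _ ≤ h * Real.log (m + 1) := hupper h
      _ ≤ 3 * (completeTree m h).thinness * Real.log (m + 1) := by gcongr
      _ = _ := by ring
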